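/- For a compact set $K \subseteq \mathbb{C}^n$ let $\widehat K = \{ z \in \mathbb{C}^n : |p(z)| \le \sup_K |p| \text{ for every polynomial } p \}$ be its polynomially convex hull, and let $P(K)$ be the closure, in the uniform norm, of the restrictions to $K$ of the polynomials in the algebra $C(K)$ of continuous complex-valued functions on $K$. A unital Banach algebra has dense invertibles if its group of invertible elements is dense in it. A uniform algebra on a non-empty compact Hausdorff space $X$ is a uniformly closed, unital subalgebra $A$ of $C(X)$ that separates the points of $X$; it is natural on $X$ if every character of $A$ is evaluation at a point of $X$ (so that $x \mapsto (f \mapsto f(x))$ identifies $X$, as a topological space, with the maximal ideal space of $A$); and its Shilov boundary $\Gamma_A$ is the minimum non-empty closed subset $K$ of $X$ such that $\sup_K |f| = \sup_X |f|$ for all $f \in A$. **Theorem 1.1.** There exists a compact set $Y \subseteq \partial\,\overline{\mathbb{D}}^{\,2}$, the topological boundary of the closed bidisk $\overline{\mathbb{D}}^{\,2} = \{(z,w) : |z| \le 1,\ |w| \le 1\}$ in $\mathbb{C}^2$, such that $(0,0) \in \widehat Y$ and $P(Y)$ has dense invertibles. Moreover, setting $X = \widehat Y$, the algebra $A := P(X)$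 is a uniform algebra that is natural on $X$ and has dense invertibles, but its Shilov boundary $\Gamma_A$ is a proper subset of $X$. -/

import Mathlib

open scoped ENNReal
open TopologicalSpace (Compacts)

/-- The uniform norm `|f|_K = sup_{x ∈ K} |f x|`, with values in `[0, ∞]`. -/
noncomputable def uniformNormOn {α : Type*} (K : Set α) (f : α → ℂ) : ℝ≥0∞ :=
  ⨆ x ∈ K, ‖f x‖ₑ

/-- The set `{z : |p z| ≤ |p|_K for all polynomials p}`, for a compact subset `K` of `ℂⁿ`. -/
def polynomialHullSet {n : ℕ} (K : Compacts (Fin n → ℂ)) : Set (Fin n → ℂ) :=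
  {z | ∀ p : MvPolynomial (Fin n) ℂ,
    ‖MvPolynomial.eval z p‖ₑ ≤ uniformNormOn (K : Set (Fin n → ℂ)) (fun y => MvPolynomial.eval y p)}

theorem uniformNormOn_ne_top {α : Type*} [TopologicalSpace α] {K : Set α} (hK : IsCompact K)
    {f : α → ℂ} (hf : Continuous f) : uniformNormOn K f ≠ ∞ := by
  obtain ⟨C, hC⟩ := hK.exists_bound_of_continuousOn hf.continuousOn
  refine ne_top_of_le_ne_top (ENNReal.ofReal_ne_top (r := C)) (iSup₂_le fun x hx => ?_)
  rw [← ofReal_norm]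
  exact ENNReal.ofReal_le_ofReal (hC x hx)

theorem isCompact_polynomialHullSet {n : ℕ} (K : Compacts (Fin n → ℂ)) :
    IsCompact (polynomialHullSet K) := by
  refine IsCompact.of_isClosed_subset (isCompact_univ_pi fun i =>
    isCompact_closedBall (0 : ℂ) (uniformNormOn (K : Set (Fin n → ℂ)) fun y => y i).toReal) ?_ ?_
  · have h : polynomialHullSet K = ⋂ p : MvPolynomial (Fin n) ℂ, {z | ‖MvPolynomial.eval z p‖ₑ ≤
        uniformNormOn (K : Set (Fin n → ℂ)) (fun y => MvPolynomial.eval y p)} := by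
      ext z
      simp [polynomialHullSet]
    rw [h]
    exact isClosed_iInter fun p =>
      isClosed_le (MvPolynomial.continuous_eval p).enorm continuous_const
  · intro z hz i _
    have h := hz (MvPolynomial.X i)
    simp only [MvPolynomial.eval_X] at h
    have h' := ENNReal.toReal_mono (uniformNormOn_ne_top K.isCompact (continuous_apply i)) h
    simpa using h'

/-- The polynomially convex hull of a compact subset `K` of `ℂⁿ`, as a compact set. -/
def polynomialHull {n : ℕ} (K : Compacts (Fin n → ℂ)) : Compacts (Fin n → ℂ) :=
  ⟨polynomialHullSet K, isCompact_polynomialHullSet K⟩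

/-- The closed bidisk in `ℂ²`. -/
def closedBidisk : Set (Fin 2 → ℂ) := {z | ∀ i, ‖z i‖ ≤ 1}

/-- Restriction of polynomials in `n` complex variables to a subset `X` of `ℂⁿ`, with values in
the algebra of continuous functions on `X`. -/
noncomputable def restrictPolynomial {n : ℕ} (X : Compacts (Fin n → ℂ)) :
    MvPolynomial (Fin n) ℂ →ₐ[ℂ] C(X, ℂ) :=
  MvPolynomial.aeval fun i =>
    ⟨fun x : X => (x : Fin n → ℂ) i, (continuous_apply i).comp continuous_subtype_val⟩

theorem restrictPolynomial_apply {n : ℕ} (X : Compacts (Fin n → ℂ)) (p : MvPolynomial (Fin n) ℂ)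
    (x : X) : restrictPolynomial X p x = MvPolynomial.eval (x : Fin n → ℂ) p := by
  induction p using MvPolynomial.induction_on with
  | C a => simp [restrictPolynomial]
  | add p q hp hq => simp [map_add, hp, hq]
  | mul_X p i hp => rw [map_mul, ContinuousMap.mul_apply, hp]; simp [restrictPolynomial]

/-- The algebra `P(X)`, for a compact set `X ⊆ ℂⁿ`: the closure in `C(X)` of the restrictions
to `X` of the polynomials. The topology of `C(X, ℂ)` is that of the uniform norm. -/
noncomputable def polynomialAlgebra {n : ℕ} (X : Compacts (Fin n → ℂ)) : Subalgebra ℂ C(X, ℂ) :=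
  (restrictPolynomial X).range.topologicalClosure

/-- The invertible elements of `A` are dense in `A`. -/
def HasDenseInvertibles (A : Type*) [Monoid A] [TopologicalSpace A] : Prop :=
  Dense {a : A | IsUnit a}

section UniformAlgebra

variable {X : Type*} [TopologicalSpace X] [CompactSpace X] [T2Space X]

/-- `A` is a uniform algebra on the non-empty compact Hausdorff space `X`: a uniformly closed
unital subalgebra of `C(X)` that separates the points of `X`. -/
structure IsUniformAlgebra (A : Subalgebra ℂ C(X, ℂ)) : Prop where
  nonempty : Nonempty X
  closed : IsClosed (A : Set C(X, ℂ))
  separates : ∀ x y : X, x ≠ y → ∃ f ∈ A, f x ≠ f y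

/-- Evaluation at the point `x`, as an element of the character space (maximal ideal space)
`Φ_A` of `A`. -/
noncomputable def evalCharacter (A : Subalgebra ℂ C(X, ℂ)) (x : X) :
    WeakDual.characterSpace ℂ A :=
  ⟨StrongDual.toWeakDual
    { toFun := fun f => (f : C(X, ℂ)) x
      map_add' := fun _ _ => rfl
      map_smul' := fun _ _ => rfl
      cont := (continuous_eval_const x).comp continuous_subtype_val },
    fun h => one_ne_zero (α := ℂ) (DFunLike.congr_fun h (1 : A)),
    fun _ _ => rfl⟩

theorem evalCharacter_apply (A : Subalgebra ℂ C(X, ℂ)) (x : X) (f : A) :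
    evalCharacter A x f = (f : C(X, ℂ)) x := rfl

/-- `A` is natural on `X`: `Φ_A = X`, where `X` is identified with point evaluations. -/
def IsNatural (A : Subalgebra ℂ C(X, ℂ)) : Prop :=
  IsHomeomorph (evalCharacter A)

/-- `K` is the Shilov boundary of `A`: the minimum among the non-empty closed subsets `K` of `X`
such that `|f|_K = |f|_X` for all `f ∈ A`. -/
def IsShilovBoundary (A : Subalgebra ℂ C(X, ℂ)) (K : Set X) : Prop :=
  IsLeast {K : Set X | K.Nonempty ∧ IsClosed K ∧
    ∀ f ∈ A, uniformNormOn K f = uniformNormOn Set.univ f} K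

end UniformAlgebra

/-! The set `Y` is the part of the unit sphere of the sup norm on which `Re q k ≥ 1/2` for every
`k`. Here `q k` is a sequence of polynomials with value 1 at the origin, each divisible by a
prescribed `g k`, and the `g k` are uniformly dense on the bidisk among the polynomials and do not
vanish at 0. On `Y` a multiple of `q k` lies within some `ρ < 1` of 1. This is a bound on a modulus,
so it passes to the hull. Hence `q k` and its divisor `g k` are invertible in `P(Y)` and in `P(Ŷ)`,
and density of the `g k` gives dense invertibles. The origin stays in the hull because the variety
`{q k = 1}` passes through it: by the maximum principle on a variety
(`exists_mem_sphere_norm_eval_le`), `|p 0| ≤ |p x|` for some `x` on the sphere with `q k x = 1`. The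
sets `{Re q k ≥ 1/2}` can be made decreasing in the bidisk (`exists_dvd_re_eval_le`), so compactness
gives one `x` that serves all `k`. Finally `Y` is a closed boundary for `P(Ŷ)`, so it contains the
Shilov boundary, while 0 is not in `Y`. -/

/-! ### Derivatives and vertical slices of polynomials in two variables. -/

open MvPolynomial in
theorem MvPolynomial.hasDerivAt_eval_update {n : ℕ} (p : MvPolynomial (Fin n) ℂ) (i : Fin n)
    (x : Fin n → ℂ) (t : ℂ) :
    HasDerivAt (fun s => eval (Function.update x i s) p)
      (eval (Function.update x i t) (pderiv i p)) t := by
  induction p using MvPolynomial.induction_on with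
  | C a => simpa using hasDerivAt_const t a
  | add p q hp hq => simp only [map_add]; exact hp.add hq
  | mul_X p j hp =>
    have hX : HasDerivAt (fun s => Function.update x i s j) (if j = i then 1 else 0) t := by
      by_cases h : j = i
      · subst h; simpa using hasDerivAt_id' t
      · simpa [Function.update_of_ne h, h] using hasDerivAt_const t (x j)
    simp only [map_mul, eval_X]
    refine (hp.mul hX).congr_deriv ?_
    rw [Derivation.leibniz, pderiv_X]
    by_cases h : j = i
    · subst h; simp; ring
    · simp [h]; ring

open MvPolynomial in
theorem MvPolynomial.hasDerivAt_eval_fst (p : MvPolynomial (Fin 2) ℂ) (z w : ℂ) :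
    HasDerivAt (fun s => eval ![s, w] p) (eval ![z, w] (pderiv 0 p)) z := by
  have h := p.hasDerivAt_eval_update 0 ![z, w] z
  have e : ∀ s, Function.update ![z, w] 0 s = ![s, w] := fun s => by
    ext i; fin_cases i <;> simp
  simpa only [e] using h

open MvPolynomial in
theorem MvPolynomial.hasDerivAt_eval_snd (p : MvPolynomial (Fin 2) ℂ) (z w : ℂ) :
    HasDerivAt (fun s => eval ![z, s] p) (eval ![z, w] (pderiv 1 p)) w := by
  have h := p.hasDerivAt_eval_update 1 ![z, w] w
  have e : ∀ s, Function.update ![z, w] 1 s = ![z, s] := fun s => by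
    ext i; fin_cases i <;> simp
  simpa only [e] using h

theorem MvPolynomial.continuous_eval_pair (p : MvPolynomial (Fin 2) ℂ) :
    Continuous fun x : ℂ × ℂ => MvPolynomial.eval ![x.1, x.2] p := by
  refine (MvPolynomial.continuous_eval p).comp (continuous_pi fun i => ?_)
  fin_cases i
  · exact continuous_fst
  · exact continuous_snd

/-- The restriction of a polynomial in two variables to the vertical line through `z`. -/
noncomputable def verticalSlice (p : MvPolynomial (Fin 2) ℂ) (z : ℂ) : Polynomial ℂ :=
  MvPolynomial.aeval ![Polynomial.C z, Polynomial.X] p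

theorem eval_verticalSlice (p : MvPolynomial (Fin 2) ℂ) (z w : ℂ) :
    (verticalSlice p z).eval w = MvPolynomial.eval ![z, w] p := by
  rw [verticalSlice]
  induction p using MvPolynomial.induction_on with
  | C a => simp
  | add p q hp hq => simp [hp, hq]
  | mul_X p i hp =>
    rw [map_mul, Polynomial.eval_mul, hp]
    fin_cases i <;> simp

theorem eval_derivative_verticalSlice (p : MvPolynomial (Fin 2) ℂ) (z w : ℂ) :
    (verticalSlice p z).derivative.eval w =
      MvPolynomial.eval ![z, w] (MvPolynomial.pderiv 1 p) := by
  have h := (verticalSlice p z).hasDerivAt w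
  simp only [eval_verticalSlice] at h
  exact h.unique (p.hasDerivAt_eval_snd z w)

/-! ### Holomorphic dependence of sums over zeros, by contour integrals. -/

open Metric MeasureTheory in
theorem differentiableAt_circleIntegral_eval_div (N f : MvPolynomial (Fin 2) ℂ) {a b : ℂ} {r s : ℝ}
    (hs : 0 < s) (hr : 0 ≤ r) (hf : ∀ z ∈ closedBall a s, ∀ w ∈ sphere b r,
      MvPolynomial.eval ![z, w] f ≠ 0) :
    DifferentiableAt ℂ
      (fun z => ∮ w in C(b, r), MvPolynomial.eval ![z, w] N / MvPolynomial.eval ![z, w] f) a := by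
  set G : ℂ → ℂ → ℂ := fun z w =>
    MvPolynomial.eval ![z, w] N / MvPolynomial.eval ![z, w] f with hG
  set G' : ℂ → ℂ → ℂ := fun z w =>
    (MvPolynomial.eval ![z, w] (MvPolynomial.pderiv 0 N) * MvPolynomial.eval ![z, w] f -
      MvPolynomial.eval ![z, w] N * MvPolynomial.eval ![z, w] (MvPolynomial.pderiv 0 f)) /
      MvPolynomial.eval ![z, w] f ^ 2 with hG'
  have hcG : ContinuousOn (fun x : ℂ × ℂ => G x.1 x.2) (closedBall a s ×ˢ sphere b r) :=
    N.continuous_eval_pair.continuousOn.div f.continuous_eval_pair.continuousOn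
      fun x hx => hf _ hx.1 _ hx.2
  have hcG' : ContinuousOn (fun x : ℂ × ℂ => G' x.1 x.2) (closedBall a s ×ˢ sphere b r) := by
    refine ContinuousOn.div (Continuous.continuousOn ?_) (Continuous.continuousOn ?_)
      fun x hx => pow_ne_zero 2 (hf _ hx.1 _ hx.2)
    · exact ((MvPolynomial.continuous_eval_pair _).mul (MvPolynomial.continuous_eval_pair _)).sub
        ((MvPolynomial.continuous_eval_pair _).mul (MvPolynomial.continuous_eval_pair _))
    · exact (MvPolynomial.continuous_eval_pair _).pow 2
  obtain ⟨C, hC⟩ := ((isCompact_closedBall a s).prod (isCompact_sphere b r))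
    |>.exists_bound_of_continuousOn hcG'
  have key : ∀ g : ℂ → ℂ → ℂ,
      ContinuousOn (fun x : ℂ × ℂ => g x.1 x.2) (closedBall a s ×ˢ sphere b r) →
      ∀ z ∈ closedBall a s,
      Continuous fun θ : ℝ => deriv (circleMap b r) θ • g z (circleMap b r θ) := by
    intro g hg z hz
    have h1 : Continuous (deriv (circleMap b r)) := by
      simp only [funext (deriv_circleMap b r)]
      exact (continuous_circleMap 0 r).mul continuous_const
    exact h1.smul (hg.comp_continuous (f := fun θ => (z, circleMap b r θ)) (by fun_prop)
      fun θ => ⟨hz, circleMap_mem_sphere b hr θ⟩)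
  have := intervalIntegral.hasDerivAt_integral_of_dominated_loc_of_deriv_le (𝕜 := ℂ) (μ := volume)
    (a := 0) (b := 2 * Real.pi)
    (F := fun z θ => deriv (circleMap b r) θ • G z (circleMap b r θ))
    (F' := fun z θ => deriv (circleMap b r) θ • G' z (circleMap b r θ))
    (x₀ := a) (bound := fun _ => r * C) (ball_mem_nhds a hs) ?_ ?_ ?_ ?_ ?_ ?_
  · exact this.2.differentiableAt
  · filter_upwards [ball_mem_nhds a hs] with z hz
    exact (key G hcG z (ball_subset_closedBall hz)).aestronglyMeasurable
  · exact (key G hcG a (mem_closedBall_self hs.le)).intervalIntegrable _ _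
  · exact (key G' hcG' a (mem_closedBall_self hs.le)).aestronglyMeasurable
  · refine Filter.Eventually.of_forall fun θ _ z hz => ?_
    rw [norm_smul]
    refine mul_le_mul ?_ (hC (z, circleMap b r θ)
      ⟨ball_subset_closedBall hz, circleMap_mem_sphere b hr θ⟩) (norm_nonneg _) hr
    simp [abs_of_nonneg hr]
  · exact intervalIntegrable_const
  · refine Filter.Eventually.of_forall fun θ _ z hz => ?_
    exact ((N.hasDerivAt_eval_fst z _).div (f.hasDerivAt_eval_fst z _)
      (hf z (ball_subset_closedBall hz) _ (circleMap_mem_sphere b hr θ))).const_mul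
        (deriv (circleMap b r) θ)

-- The weighted argument principle: `P'/P` is the sum of `1/(w - c)` over the roots `c` with
-- multiplicity, and Cauchy's formula evaluates each term.
open Metric Classical in
theorem circleIntegral_mul_derivative_div (P : Polynomial ℂ) {h : ℂ → ℂ} (hh : Differentiable ℂ h)
    {b : ℂ} {r : ℝ} (hr : 0 < r) (hP : ∀ w ∈ sphere b r, P.eval w ≠ 0) :
    ∮ w in C(b, r), h w * P.derivative.eval w / P.eval w =
      2 * Real.pi * Complex.I * ((P.roots.filter (· ∈ ball b r)).map h).sum := by
  classical
  have hroot : ∀ c ∈ P.roots, c ∉ sphere b r := fun c hc hcs =>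
    hP c hcs (Polynomial.isRoot_of_mem_roots hc)
  have h1 : ∮ w in C(b, r), h w * P.derivative.eval w / P.eval w =
      ∮ w in C(b, r), (P.roots.map fun c => h w / (w - c)).sum := by
    refine circleIntegral.integral_congr hr.le fun w hw => ?_
    rw [mul_div_assoc, (IsAlgClosed.splits P).eval_derivative_div_eval_of_ne_zero (hP w hw),
      ← Multiset.sum_map_mul_left]
    simp [div_eq_mul_inv]
  rw [h1]
  clear h1 hP
  revert hroot
  induction P.roots using Multiset.induction_on with
  | empty => simp [circleIntegral]
  | cons c m ih =>
    intro hroot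
    have hcont : ∀ c ∉ sphere b r, ContinuousOn (fun w => h w / (w - c)) (sphere b r) :=
      fun c hc => hh.continuous.continuousOn.div (by fun_prop) fun w hw hwc =>
        hc (sub_eq_zero.1 hwc ▸ hw)
    have hm : ∀ x ∈ m, x ∉ sphere b r := fun x hx => hroot x (Multiset.mem_cons_of_mem hx)
    have hc := hroot c (Multiset.mem_cons_self c m)
    have hcm : ContinuousOn (fun w => (m.map fun c => h w / (w - c)).sum) (sphere b r) := by
      have := continuousOn_multiset_sum (f := fun c w => h w / (w - c)) m
        fun x hx => hcont x (hm x hx)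
      simpa using this
    simp only [Multiset.map_cons, Multiset.sum_cons]
    rw [circleIntegral.integral_add ((hcont c hc).circleIntegrable hr.le)
      (hcm.circleIntegrable hr.le), ih hm]
    by_cases hcb : c ∈ ball b r
    · rw [Multiset.filter_cons_of_pos _ hcb, Multiset.map_cons, Multiset.sum_cons, mul_add]
      congr 1
      have := (hh.differentiableOn (s := closedBall b r)).circleIntegral_sub_inv_smul hcb
      simpa [div_eq_inv_mul] using this
    · rw [Multiset.filter_cons_of_neg _ hcb]
      have : ∮ w in C(b, r), h w / (w - c) = 0 := by
        have hcc : c ∉ closedBall b r := by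
          rw [← ball_union_sphere]; exact fun h => h.elim hcb hc
        refine DiffContOnCl.circleIntegral_eq_zero hr.le ?_
        rw [← closure_ball b hr.ne'] at hcc
        refine DifferentiableOn.diffContOnCl fun w hw => ?_
        exact (hh w).differentiableWithinAt.div (by fun_prop) fun hwc =>
          hcc (sub_eq_zero.1 hwc ▸ hw)
      rw [this, zero_add]

-- A nonzero slice has isolated zeros, so a small circle about `b` avoids them; by the tube lemma
-- this persists on nearby vertical lines.
open Metric in
theorem exists_forall_eval_ne_zero_on_sphere (f : MvPolynomial (Fin 2) ℂ) {a : ℂ}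
    (ha : verticalSlice f a ≠ 0) (b : ℂ) {ε : ℝ} (hε : 0 < ε) :
    ∃ r s : ℝ, 0 < r ∧ r < ε ∧ 0 < s ∧ s < ε ∧
      (∀ z ∈ closedBall a s, ∀ w ∈ sphere b r, MvPolynomial.eval ![z, w] f ≠ 0) ∧
      ∀ w ∈ ball b r, MvPolynomial.eval ![a, w] f = 0 → w = b := by
  have hfin : ((verticalSlice f a).rootSet ℂ \ {b}).Finite :=
    ((verticalSlice f a).rootSet_finite ℂ).sdiff
  obtain ⟨δ, hδ, hδr⟩ := Metric.isOpen_iff.1 hfin.isClosed.isOpen_compl b (fun h => h.2 rfl)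
  have hroot : ∀ w ∈ ball b δ, MvPolynomial.eval ![a, w] f = 0 → w = b := fun w hw h0 => by
    by_contra hwb
    refine hδr hw ⟨?_, hwb⟩
    rw [Polynomial.mem_rootSet]
    exact ⟨ha, by simpa [Polynomial.aeval_def, eval_verticalSlice] using h0⟩
  obtain ⟨r, hr, hrε⟩ := exists_between (lt_min hδ hε)
  have hra : ∀ w ∈ sphere b r, MvPolynomial.eval ![a, w] f ≠ 0 := fun w hw h0 => by
    have hwb := hroot w (by rw [mem_ball, mem_sphere.1 hw]; exact hrε.trans_le (min_le_left _ _)) h0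
    rw [hwb, mem_sphere, dist_self] at hw
    exact hr.ne hw
  have hopen : IsOpen {x : ℂ × ℂ | MvPolynomial.eval ![x.1, x.2] f ≠ 0} :=
    isOpen_ne_fun f.continuous_eval_pair continuous_const
  obtain ⟨U, V, hU, -, haU, hV, hUV⟩ := generalized_tube_lemma (isCompact_singleton (x := a))
    (isCompact_sphere b r) hopen (by
      rintro ⟨z, w⟩ ⟨hz, hw⟩
      obtain rfl : z = a := hz
      exact hra w hw)
  obtain ⟨η, hη, hηU⟩ := Metric.isOpen_iff.1 hU a (haU rfl)
  obtain ⟨s, hs, hsη⟩ := exists_between (lt_min hη hε)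
  refine ⟨r, s, hr, hrε.trans_le (min_le_right _ _), hs, hsη.trans_le (min_le_right _ _),
    fun z hz w hw => ?_, fun w hw =>
      hroot w (ball_subset_ball (hrε.trans_le (min_le_left _ _)).le hw)⟩
  have hzη : z ∈ ball a η := closedBall_subset_ball (hsη.trans_le (min_le_left _ _)) hz
  have hzw : (z, w) ∈ {x : ℂ × ℂ | MvPolynomial.eval ![x.1, x.2] f ≠ 0} :=
    hUV (Set.mk_mem_prod (hηU hzη) (hV hw))
  rw [Set.mem_ofPred_eq] at hzw
  exact hzw

theorem Multiset.re_sum_nonpos (m : Multiset ℂ) (h : ∀ x ∈ m, x.re ≤ 0) : m.sum.re ≤ 0 := by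
  induction m using Multiset.induction_on with
  | empty => simp
  | cons c m ih =>
    have := h c (Multiset.mem_cons_self c m)
    have := ih fun x hx => h x (Multiset.mem_cons_of_mem hx)
    simp only [Multiset.sum_cons, Complex.add_re]
    linarith

open Metric Classical in
/-- For a polynomial `h`, the sum of the values of `h` at the zeros of `f` on a vertical line which
lie in a disc depends holomorphically on the line. -/
theorem differentiableOn_sum_roots (f h : MvPolynomial (Fin 2) ℂ) {a b : ℂ} {r s : ℝ} (hr : 0 < r)
    (hf : ∀ z ∈ closedBall a s, ∀ w ∈ sphere b r, MvPolynomial.eval ![z, w] f ≠ 0) :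
    DifferentiableOn ℂ (fun z => (((verticalSlice f z).roots.filter (· ∈ ball b r)).map
      fun w => MvPolynomial.eval ![z, w] h).sum) (ball a s) := by
  have hD : DifferentiableOn ℂ (fun z => (2 * Real.pi * Complex.I)⁻¹ * ∮ w in C(b, r),
      MvPolynomial.eval ![z, w] (h * MvPolynomial.pderiv 1 f) / MvPolynomial.eval ![z, w] f)
      (ball a s) := fun z hz => by
    refine ((differentiableAt_circleIntegral_eval_div _ f (s := s - dist z a)
      (sub_pos.2 hz) hr.le fun z' hz' => hf z' ?_).const_mul _).differentiableWithinAt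
    exact closedBall_subset_closedBall' (by linarith) hz'
  refine hD.congr fun z hz => ?_
  have := circleIntegral_mul_derivative_div (verticalSlice f z)
    (h := fun w => MvPolynomial.eval ![z, w] h)
    (fun w => (h.hasDerivAt_eval_snd z w).differentiableAt) (b := b) hr
    (fun w hw => by rw [eval_verticalSlice]; exact hf z (ball_subset_closedBall hz) w hw)
  simp only [eval_derivative_verticalSlice, eval_verticalSlice] at this
  simp only [map_mul]
  rw [this, inv_mul_cancel_left₀ Complex.two_pi_I_ne_zero]

/-! ### The maximum principle on a plane algebraic set. -/

open Metric Classical in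
/-- If `|p|` has a local maximum on `{f = 0}` at `(a, b)`, then on every vertical line near `(a, b)`
there is a point of `{f = 0}` near `(a, b)` where `|p|` takes the same value. -/
theorem exists_norm_eval_eq_of_isLocalMax (f p : MvPolynomial (Fin 2) ℂ) {a b : ℂ}
    (ha : verticalSlice f a ≠ 0) (hab : MvPolynomial.eval ![a, b] f = 0) {ε : ℝ} (hε : 0 < ε)
    (hmax : ∀ z ∈ ball a ε, ∀ w ∈ ball b ε, MvPolynomial.eval ![z, w] f = 0 →
      ‖MvPolynomial.eval ![z, w] p‖ ≤ ‖MvPolynomial.eval ![a, b] p‖) :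
    ∀ᶠ z in nhds a, ∃ w ∈ ball b ε, MvPolynomial.eval ![z, w] f = 0 ∧
      ‖MvPolynomial.eval ![z, w] p‖ = ‖MvPolynomial.eval ![a, b] p‖ := by
  obtain ⟨r, s, hr, hrε, hs, hsε, hf, hb⟩ := exists_forall_eval_ne_zero_on_sphere f ha b hε
  obtain ⟨u, hu, hup⟩ : ∃ u : ℂ, ‖u‖ = 1 ∧
      u * MvPolynomial.eval ![a, b] p = ‖MvPolynomial.eval ![a, b] p‖ := by
    by_cases h0 : MvPolynomial.eval ![a, b] p = 0
    · exact ⟨1, by simp, by simp [h0]⟩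
    · refine ⟨‖MvPolynomial.eval ![a, b] p‖ / MvPolynomial.eval ![a, b] p, by simp [h0],
        by field_simp⟩
  set M : ℝ := ‖MvPolynomial.eval ![a, b] p‖ with hM
  let Z : ℂ → Multiset ℂ := fun z => (verticalSlice f z).roots.filter (· ∈ ball b r)
  have hZ : ∀ z, ∀ w ∈ Z z, MvPolynomial.eval ![z, w] f = 0 ∧ w ∈ ball b r := fun z w hw => by
    obtain ⟨h1, h2⟩ := Multiset.mem_filter.1 hw
    exact ⟨by rw [← eval_verticalSlice]; exact Polynomial.isRoot_of_mem_roots h1, h2⟩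
  -- Each term `u p - M` has nonpositive real part by maximality and vanishes at `(a, b)`. So `|exp
  -- D|` has an interior maximum at `a`, hence `Re D = 0` throughout, and every single term has real
  -- part 0.
  let D : ℂ → ℂ := fun z => ((Z z).map fun w =>
    MvPolynomial.eval ![z, w] (MvPolynomial.C u * p - MvPolynomial.C (M : ℂ))).sum
  have hDd : DifferentiableOn ℂ D (ball a s) := differentiableOn_sum_roots f _ hr hf
  have hterm : ∀ z ∈ ball a s, ∀ w ∈ Z z,
      (MvPolynomial.eval ![z, w] (MvPolynomial.C u * p - MvPolynomial.C (M : ℂ))).re ≤ 0 := by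
    intro z hz w hw
    have h1 := hmax z (ball_subset_ball hsε.le hz) w (ball_subset_ball hrε.le (hZ z w hw).2)
      (hZ z w hw).1
    have h2 := Complex.re_le_norm (u * MvPolynomial.eval ![z, w] p)
    rw [norm_mul, hu, one_mul] at h2
    simp only [map_sub, map_mul, MvPolynomial.eval_C, Complex.sub_re, Complex.ofReal_re]
    linarith
  have hDre : ∀ z ∈ ball a s, (D z).re ≤ 0 := fun z hz => by
    refine Multiset.re_sum_nonpos _ fun x hx => ?_
    obtain ⟨w, hw, rfl⟩ := Multiset.mem_map.1 hx
    exact hterm z hz w hw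
  have hDa : D a = 0 := by
    refine Multiset.sum_eq_zero fun x hx => ?_
    obtain ⟨w, hw, rfl⟩ := Multiset.mem_map.1 hx
    obtain rfl := hb w (hZ a w hw).2 (hZ a w hw).1
    simp [hup]
  have hre : ∀ z ∈ ball a s, (D z).re = 0 := fun z hz => by
    have := Complex.norm_eqOn_of_isPreconnected_of_isMaxOn (f := fun z => Complex.exp (D z))
      (convex_ball a s).isPreconnected isOpen_ball hDd.cexp (mem_ball_self hs) (fun z hz => by
        simpa [Complex.norm_exp, hDa] using hDre z hz) hz
    simpa [Complex.norm_exp, hDa] using this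
  -- With weight 1 the sum counts zeros: it is continuous in `z` and nonzero at `a`, so zeros exist
  -- on nearby lines.
  have hNa : ∀ᶠ z in nhds a, ((Z z).map fun w => MvPolynomial.eval ![z, w] 1).sum ≠ 0 := by
    have hN := (differentiableOn_sum_roots f 1 hr hf).continuousOn.continuousAt (ball_mem_nhds a hs)
    refine hN.eventually_ne ?_
    have : b ∈ Z a := Multiset.mem_filter.2 ⟨(Polynomial.mem_roots ha).2
      (by rw [Polynomial.IsRoot, eval_verticalSlice, hab]), mem_ball_self hr⟩
    have h0 : (Z a).card ≠ 0 := fun h0 => by simp [Multiset.card_eq_zero.1 h0] at this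
    simpa [Z] using h0
  filter_upwards [hNa, ball_mem_nhds a hs] with z hNz hz
  obtain ⟨w, hw⟩ := Multiset.exists_mem_of_ne_zero (s := Z z) (fun h0 => by simp [h0] at hNz)
  have hzw := hmax z (ball_subset_ball hsε.le hz) w (ball_subset_ball hrε.le (hZ z w hw).2)
    (hZ z w hw).1
  refine ⟨w, ball_subset_ball hrε.le (hZ z w hw).2, (hZ z w hw).1, hzw.antisymm ?_⟩
  obtain ⟨m, hm⟩ := Multiset.exists_cons_of_mem hw
  have hrest : ((m.map fun w => MvPolynomial.eval ![z, w]
      (MvPolynomial.C u * p - MvPolynomial.C (M : ℂ))).sum).re ≤ 0 := by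
    refine Multiset.re_sum_nonpos _ fun x hx => ?_
    obtain ⟨w', hw', rfl⟩ := Multiset.mem_map.1 hx
    exact hterm z hz w' (hm ▸ Multiset.mem_cons_of_mem hw')
  have h0 := hre z hz
  simp only [D, hm, Multiset.map_cons, Multiset.sum_cons, Complex.add_re] at h0
  have h1 := Complex.re_le_norm (u * MvPolynomial.eval ![z, w] p)
  rw [norm_mul, hu, one_mul] at h1
  simp only [map_sub, map_mul, MvPolynomial.eval_C, Complex.sub_re, Complex.ofReal_re] at h0 hrest
  linarith

open Metric in
/-- The maximum principle on the analytic set `{f = 0}` in the closed bidisk. -/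
theorem exists_mem_sphere_norm_eval_le (f p : MvPolynomial (Fin 2) ℂ)
    (hf : MvPolynomial.eval 0 f = 0) :
    ∃ x ∈ sphere (0 : Fin 2 → ℂ) 1, MvPolynomial.eval x f = 0 ∧
      ‖MvPolynomial.eval 0 p‖ ≤ ‖MvPolynomial.eval x p‖ := by
  have hpair : ∀ x : Fin 2 → ℂ, ![x 0, x 1] = x := fun x => by ext i; fin_cases i <;> rfl
  have hnorm : ∀ x : Fin 2 → ℂ, ‖x‖ = max ‖x 0‖ ‖x 1‖ := fun x => by
    simp [Pi.norm_def, Fin.univ_succ, Finset.sup_insert]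
  set V : Set (Fin 2 → ℂ) := closedBall 0 1 ∩ {x | MvPolynomial.eval x f = 0} with hV
  have hVc : IsCompact V := (isCompact_closedBall 0 1).inter_right
    (isClosed_eq (MvPolynomial.continuous_eval f) continuous_const)
  have hp : Continuous fun x => ‖MvPolynomial.eval x p‖ := (MvPolynomial.continuous_eval p).norm
  have hV0 : (0 : Fin 2 → ℂ) ∈ V := ⟨by simp, hf⟩
  obtain ⟨y, hyV, hy⟩ := hVc.exists_isMaxOn ⟨0, hV0⟩ hp.continuousOn
  set M := ‖MvPolynomial.eval y p‖ with hM
  have hEc : IsCompact (V ∩ {x | ‖MvPolynomial.eval x p‖ = M}) :=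
    hVc.inter_right (isClosed_eq hp continuous_const)
  -- Among the points where `|p|` is maximal on `V`, `x` has the largest `|x 0|`. If it were
  -- interior with a nonzero slice, the maximum would also be attained on nearby lines with larger
  -- `|z|`, a contradiction.
  obtain ⟨x, ⟨hxV, hxM⟩, hx⟩ := hEc.exists_isMaxOn ⟨y, hyV, rfl⟩
    (continuous_apply (0 : Fin 2)).norm.continuousOn
  have h0M : ‖MvPolynomial.eval 0 p‖ ≤ M := hy hV0
  by_cases hxs : x ∈ sphere (0 : Fin 2 → ℂ) 1
  · exact ⟨x, hxs, hxV.2, h0M.trans_eq hxM.symm⟩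
  have hx1 : ‖x‖ < 1 := by
    rw [mem_sphere_zero_iff_norm] at hxs
    exact lt_of_le_of_ne (mem_closedBall_zero_iff.1 hxV.1) hxs
  obtain ⟨hx10, hx11⟩ := max_lt_iff.1 (hnorm x ▸ hx1)
  by_cases hsl : verticalSlice f (x 0) = 0
  -- Here the whole vertical line lies in `{f = 0}`, and the maximum principle in one variable
  -- reaches the sphere.
  · have hline : ∀ w, MvPolynomial.eval ![x 0, w] f = 0 := fun w => by
      rw [← eval_verticalSlice, hsl, Polynomial.eval_zero]
    obtain ⟨w, hw, hwmax⟩ := Complex.exists_mem_frontier_isMaxOn_norm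
      
      (isBounded_ball (x := (0 : ℂ)) (r := 1))
      ⟨0, by simp⟩ (f := fun w => MvPolynomial.eval ![x 0, w] p)
      (Differentiable.diffContOnCl fun w => (p.hasDerivAt_eval_snd (x 0) w).differentiableAt)
    rw [frontier_ball _ one_ne_zero, mem_sphere_zero_iff_norm] at hw
    refine ⟨![x 0, w], ?_, hline w, h0M.trans ?_⟩
    · rw [mem_sphere_zero_iff_norm, hnorm]
      simp [hw, hx10.le]
    · have := hwmax (subset_closure (mem_ball_zero_iff.2 hx11))
      simp only [Set.mem_ofPred_eq, Function.comp, hpair] at this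
      exact hxM ▸ this
  · exfalso
    obtain ⟨ε, hε, hε0, hε1⟩ : ∃ ε > 0, ‖x 0‖ + ε ≤ 1 ∧ ‖x 1‖ + ε ≤ 1 :=
      ⟨min (1 - ‖x 0‖) (1 - ‖x 1‖), lt_min (by linarith) (by linarith),
        by linarith [min_le_left (1 - ‖x 0‖) (1 - ‖x 1‖)],
        by linarith [min_le_right (1 - ‖x 0‖) (1 - ‖x 1‖)]⟩
    have hmem : ∀ z ∈ ball (x 0) ε, ∀ w ∈ ball (x 1) ε, ![z, w] ∈ closedBall (0 : Fin 2 → ℂ) 1 := by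
      intro z hz w hw
      rw [mem_ball, dist_eq_norm] at hz hw
      rw [mem_closedBall_zero_iff, hnorm]
      have h1 := norm_le_norm_add_norm_sub' z (x 0)
      have h2 := norm_le_norm_add_norm_sub' w (x 1)
      exact max_le (by simp; linarith) (by simp; linarith)
    have hev := exists_norm_eval_eq_of_isLocalMax f p (a := x 0) (b := x 1) hsl
      (by rw [hpair]; exact hxV.2) hε fun z hz w hw h => by
        rw [hpair, hxM]; exact hy ⟨hmem z hz w hw, h⟩
    have hcl : x 0 ∈ closure {z : ℂ | ‖x 0‖ < ‖z‖} := by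
      have : {z : ℂ | ‖x 0‖ < ‖z‖} = (closedBall 0 ‖x 0‖)ᶜ := by
        ext z; simp
      rw [this, closure_compl, interior_closedBall']
      simp
    obtain ⟨z, hz, ⟨w, hw, hzw, hzwM⟩, hzε⟩ := (mem_closure_iff_frequently.1 hcl).and_eventually
      (hev.and (ball_mem_nhds (x 0) hε)) |>.exists
    rw [hpair, hxM] at hzwM
    have := hx ⟨⟨hmem z hzε w hw, hzw⟩, hzwM⟩
    exact absurd this (by simpa using hz)

/-! ### Existence of the Shilov boundary. -/

section Shilov

variable {X : Type*} [TopologicalSpace X]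

/-- A closed set on which every function in `A` attains its maximum modulus. -/
def IsClosedBoundary (A : Subalgebra ℂ C(X, ℂ)) (K : Set X) : Prop :=
  IsClosed K ∧ ∀ f ∈ A, ∀ x, ∃ y ∈ K, ‖f x‖ ≤ ‖f y‖

theorem IsClosedBoundary.nonempty [Nonempty X] {A : Subalgebra ℂ C(X, ℂ)} {K : Set X}
    (h : IsClosedBoundary A K) : K.Nonempty := by
  obtain ⟨y, hy, -⟩ := h.2 1 A.one_mem (Classical.arbitrary X)
  exact ⟨y, hy⟩

variable [CompactSpace X]

theorem uniformNormOn_eq_univ_iff {K : Set X} (hK : IsClosed K) (hne : K.Nonempty) (f : C(X, ℂ)) :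
    uniformNormOn K f = uniformNormOn Set.univ f ↔ ∀ x, ∃ y ∈ K, ‖f x‖ ≤ ‖f y‖ := by
  constructor
  · intro h x
    obtain ⟨y, hy, hmax⟩ := hK.isCompact.exists_isMaxOn hne f.continuous.norm.continuousOn
    refine ⟨y, hy, ?_⟩
    have h1 : ‖f x‖ₑ ≤ uniformNormOn K f := by
      rw [h]
      exact le_iSup₂ (f := fun x (_ : x ∈ Set.univ) => ‖f x‖ₑ) x trivial
    have h2 : uniformNormOn K f ≤ ‖f y‖ₑ := iSup₂_le fun z hz => enorm_le_iff_norm_le.2 (hmax hz)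
    exact enorm_le_iff_norm_le.1 (h1.trans h2)
  · intro h
    refine le_antisymm (iSup₂_le fun x _ =>
      le_iSup₂ (f := fun x (_ : x ∈ Set.univ) => ‖f x‖ₑ) x trivial) (iSup₂_le fun x _ => ?_)
    obtain ⟨y, hy, hxy⟩ := h x
    exact (enorm_le_iff_norm_le.2 hxy).trans (le_iSup₂ (f := fun x (_ : x ∈ K) => ‖f x‖ₑ) y hy)

theorem isClosedBoundary_iff [Nonempty X] {A : Subalgebra ℂ C(X, ℂ)} {K : Set X} :
    IsClosedBoundary A K ↔ K.Nonempty ∧ IsClosed K ∧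
      ∀ f ∈ A, uniformNormOn K f = uniformNormOn Set.univ f :=
  ⟨fun h => ⟨h.nonempty, h.1, fun f hf =>
      (uniformNormOn_eq_univ_iff h.1 h.nonempty f).2 (h.2 f hf)⟩,
    fun h => ⟨h.2.1, fun f hf => (uniformNormOn_eq_univ_iff h.2.1 h.1 f).1 (h.2.2 f hf)⟩⟩

theorem exists_minimal_isClosedBoundary [Nonempty X] (A : Subalgebra ℂ C(X, ℂ)) :
    ∃ S, Minimal (IsClosedBoundary A) S := by
  refine zorn_superset {K | IsClosedBoundary A K} fun c hcA hc => ?_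
  rcases c.eq_empty_or_nonempty with rfl | hne
  · exact ⟨Set.univ, ⟨isClosed_univ, fun f _ x => ⟨x, trivial, le_rfl⟩⟩, by simp⟩
  refine ⟨⋂₀ c, ⟨isClosed_sInter fun K hK => (hcA hK).1, fun f hf x => ?_⟩,
    fun K hK => Set.sInter_subset_of_mem hK⟩
  have : Nonempty c := hne.to_subtype
  have hcl : ∀ K : c, IsClosed ((K : Set X) ∩ {y | ‖f x‖ ≤ ‖f y‖}) := fun K =>
    (hcA K.2).1.inter (isClosed_le continuous_const f.continuous.norm)
  obtain ⟨y, hy⟩ := IsCompact.nonempty_iInter_of_directed_nonempty_isCompact_isClosed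
    (fun K : c => (K : Set X) ∩ {y | ‖f x‖ ≤ ‖f y‖})
    (fun K L => (hc.total K.2 L.2).elim
      (fun h => ⟨K, subset_rfl, Set.inter_subset_inter_left _ h⟩)
      (fun h => ⟨L, Set.inter_subset_inter_left _ h, subset_rfl⟩))
    (fun K => (hcA K.2).2 f hf x) (fun K => (hcl K).isCompact) hcl
  rw [Set.mem_iInter] at hy
  exact ⟨y, fun K hK => (hy ⟨K, hK⟩).1, (hy ⟨_, hne.some_mem⟩).2⟩

/-- If `A` separates points, the sets `{y | ∀ f ∈ F, |f y| < 1}`, for finite sets `F` of functions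
in `A` vanishing at `x`, are a base of neighbourhoods of `x`. -/
theorem exists_finset_forall_norm_lt_one {A : Subalgebra ℂ C(X, ℂ)}
    (hsep : ∀ x y : X, x ≠ y → ∃ f ∈ A, f x ≠ f y) {x : X} {U : Set X} (hU : IsOpen U)
    (hx : x ∈ U) :
    ∃ F : Finset C(X, ℂ), (∀ f ∈ F, f ∈ A ∧ f x = 0) ∧ ∀ y, (∀ f ∈ F, ‖f y‖ < 1) → y ∈ U := by
  classical
  have h : ∀ y : X, ∃ f : C(X, ℂ), y ∈ Uᶜ → f ∈ A ∧ f x = 0 ∧ 1 < ‖f y‖ := fun y => by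
    by_cases hy : y ∈ Uᶜ
    · obtain ⟨f, hf, hxy⟩ := hsep y x fun h => hy (h ▸ hx)
      have hne : f y - f x ≠ 0 := sub_ne_zero.2 hxy
      refine ⟨(2 / (f y - f x)) • (f - algebraMap ℂ _ (f x)), fun _ => ⟨?_, ?_, ?_⟩⟩
      · exact A.smul_mem (A.sub_mem hf (A.algebraMap_mem _)) _
      · simp
      · simp [hne]
    · exact ⟨0, fun h => absurd h hy⟩
  choose f hf using h
  obtain ⟨t, htU, ht⟩ := hU.isClosed_compl.isCompact.elim_nhds_subcover
    (fun y => {z | y ∈ Uᶜ → 1 < ‖f y z‖}) fun y hy => by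
      filter_upwards [(isOpen_lt continuous_const (f y).continuous.norm).mem_nhds (hf y hy).2.2]
        with z hz _ using hz
  refine ⟨t.image f, fun g hg => ?_, fun y hy => ?_⟩
  · obtain ⟨y, hy, rfl⟩ := Finset.mem_image.1 hg
    exact ⟨(hf y (htU y hy)).1, (hf y (htU y hy)).2.1⟩
  · by_contra hyU
    obtain ⟨z, hzt, hz⟩ := Set.mem_iUnion₂.1 (ht hyU)
    exact (hz (htU z hzt)).not_gt (hy _ (Finset.mem_image_of_mem f hzt))

/-- Near `x ∈ S` take a basic neighbourhood `V` cut out by `F`. By minimality `S \ V` is not a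
boundary, so some `g` of norm 1 has `|g| < 1` there. For large `m`, `|g ^ m * f| < 1` on `S`, hence
everywhere; a point of `T` where `|g| = 1` then lies in `V`. -/
theorem minimal_isClosedBoundary_subset [Nonempty X] {A : Subalgebra ℂ C(X, ℂ)}
    (hsep : ∀ x y : X, x ≠ y → ∃ f ∈ A, f x ≠ f y) {S T : Set X}
    (hS : Minimal (IsClosedBoundary A) S) (hT : IsClosedBoundary A T) : S ⊆ T := by
  intro x hxS
  rw [← hT.1.closure_eq, mem_closure_iff]
  intro U hU hxU
  obtain ⟨F, hF, hFU⟩ := exists_finset_forall_norm_lt_one hsep hU hxU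
  set V : Set X := {y | ∀ f ∈ F, ‖f y‖ < 1} with hV
  have hVo : IsOpen V := by
    have : V = ⋂ f ∈ F, {y | ‖f y‖ < 1} := by ext; simp [hV]
    rw [this]
    exact isOpen_biInter_finset fun f _ => isOpen_lt f.continuous.norm continuous_const
  have hxV : x ∈ V := fun f hf => by simp [(hF f hf).2]
  have hcl : IsClosed (S \ V) := hS.prop.1.sdiff hVo
  obtain ⟨g, hgA, x₁, hg1, hx₁, hgS⟩ : ∃ g ∈ A, ∃ x₁, (∀ y, ‖g y‖ ≤ 1) ∧ ‖g x₁‖ = 1 ∧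
      ∀ y ∈ S \ V, ‖g y‖ < 1 := by
    rcases (S \ V).eq_empty_or_nonempty with he | ⟨z, hz⟩
    · exact ⟨1, A.one_mem, x, by simp, by simp, by simp [he]⟩
    · have hn : ¬ IsClosedBoundary A (S \ V) := fun h =>
        (hS.le_of_le h Set.sdiff_subset hxS).2 hxV
      simp only [IsClosedBoundary, hcl, true_and] at hn
      push Not at hn
      obtain ⟨f, hf, x₀, hx₀⟩ := hn
      obtain ⟨x₁, -, hx₁⟩ := isCompact_univ.exists_isMaxOn ⟨x, trivial⟩
        f.continuous.norm.continuousOn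
      have hlt : ∀ y ∈ S \ V, ‖f y‖ < ‖f x₁‖ := fun y hy =>
        (hx₀ y hy).trans_le (hx₁ (Set.mem_univ x₀))
      have hpos : 0 < ‖f x₁‖ := (norm_nonneg _).trans_lt (hlt z hz)
      have hne : f x₁ ≠ 0 := norm_pos_iff.1 hpos
      refine ⟨(f x₁)⁻¹ • f, A.smul_mem hf _, x₁, fun y => ?_, by simp [hne], fun y hy => ?_⟩
      · have : ‖f y‖ ≤ ‖f x₁‖ := hx₁ (Set.mem_univ y)
        simpa [← div_eq_inv_mul] using (div_le_one hpos).2 this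
      · simpa [← div_eq_inv_mul] using (div_lt_one hpos).2 (hlt y hy)
  obtain ⟨m, hm⟩ : ∃ m : ℕ, ∀ f ∈ F, ∀ y ∈ S \ V, ‖g y‖ ^ m * ‖f y‖ < 1 := by
    rcases (S \ V).eq_empty_or_nonempty with he | hne
    · exact ⟨0, by simp [he]⟩
    · obtain ⟨z, hz, hzmax⟩ := hcl.isCompact.exists_isMaxOn hne g.continuous.norm.continuousOn
      set C : ℝ := ∑ f ∈ F, ‖f‖ with hC
      have hC0 : 0 ≤ C := Finset.sum_nonneg fun f _ => norm_nonneg f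
      obtain ⟨m, hm⟩ := exists_pow_lt_of_lt_one (show (0 : ℝ) < 1 / (C + 1) by positivity)
        (hgS z hz)
      refine ⟨m, fun f hf y hy => ?_⟩
      have h1 : ‖g y‖ ^ m ≤ 1 / (C + 1) :=
        (pow_le_pow_left₀ (norm_nonneg _) (hzmax hy) m).trans hm.le
      have h2 : ‖f y‖ ≤ C := (f.norm_coe_le_norm y).trans
        (Finset.single_le_sum (f := fun f => ‖f‖) (fun f _ => norm_nonneg f) hf)
      calc ‖g y‖ ^ m * ‖f y‖ ≤ 1 / (C + 1) * C := by gcongr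
        _ < 1 := by rw [one_div_mul_eq_div, div_lt_one (by positivity)]; linarith
  have hlt : ∀ f ∈ F, ∀ y, ‖g y‖ ^ m * ‖f y‖ < 1 := fun f hf y => by
    obtain ⟨z, hzS, hz⟩ := hS.prop.2 (g ^ m * f) (A.mul_mem (A.pow_mem hgA m) (hF f hf).1) y
    simp only [ContinuousMap.mul_apply, ContinuousMap.pow_apply, norm_mul, norm_pow] at hz
    refine hz.trans_lt ?_
    by_cases hzV : z ∈ V
    · calc ‖g z‖ ^ m * ‖f z‖ ≤ 1 * ‖f z‖ := by
            gcongr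
            exact pow_le_one₀ (norm_nonneg _) (hg1 z)
        _ < 1 := by rw [one_mul]; exact hzV f hf
    · exact hm f hf z ⟨hzS, hzV⟩
  obtain ⟨y, hyT, hy⟩ := hT.2 g hgA x₁
  have hgy : ‖g y‖ = 1 := (hg1 y).antisymm (hx₁ ▸ hy)
  exact ⟨y, hFU y fun f hf => by simpa [hgy] using hlt f hf y, hyT⟩

theorem exists_isShilovBoundary [T2Space X] {A : Subalgebra ℂ C(X, ℂ)} (hA : IsUniformAlgebra A) :
    ∃ S, IsShilovBoundary A S := by
  have := hA.nonempty
  obtain ⟨S, hS⟩ := exists_minimal_isClosedBoundary A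
  exact ⟨S, isClosedBoundary_iff.1 hS.prop, fun T hT =>
    minimal_isClosedBoundary_subset hA.separates hS (isClosedBoundary_iff.2 hT)⟩

end Shilov

/-! ### The algebra `P(X)`: density of polynomials, invertibility, characters. -/

section PolynomialAlgebra

variable {n : ℕ}

/-- Restriction of polynomials, as a map into `P(X)`. -/
noncomputable def toPolynomialAlgebra (X : Compacts (Fin n → ℂ)) :
    MvPolynomial (Fin n) ℂ →ₐ[ℂ] polynomialAlgebra X :=
  (restrictPolynomial X).codRestrict _ fun p =>
    Subalgebra.le_topologicalClosure _ ⟨p, rfl⟩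

theorem toPolynomialAlgebra_apply (X : Compacts (Fin n → ℂ)) (p : MvPolynomial (Fin n) ℂ) (x : X) :
    (toPolynomialAlgebra X p : C(X, ℂ)) x = MvPolynomial.eval (x : Fin n → ℂ) p :=
  restrictPolynomial_apply X p x

theorem denseRange_toPolynomialAlgebra (X : Compacts (Fin n → ℂ)) :
    DenseRange (toPolynomialAlgebra X) := by
  rw [DenseRange, Subtype.dense_iff]
  intro f hf
  refine closure_mono ?_ (show f ∈ closure ((restrictPolynomial X).range : Set C(X, ℂ)) from hf)
  rintro _ ⟨p, rfl⟩
  exact ⟨_, ⟨p, rfl⟩, rfl⟩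

theorem isClosed_polynomialAlgebra (X : Compacts (Fin n → ℂ)) :
    IsClosed (polynomialAlgebra X : Set C(X, ℂ)) :=
  Subalgebra.isClosed_topologicalClosure _

instance completeSpace_polynomialAlgebra (X : Compacts (Fin n → ℂ)) :
    CompleteSpace (polynomialAlgebra X) :=
  (isClosed_polynomialAlgebra X).completeSpace_coe

theorem isUniformAlgebra_polynomialAlgebra (X : Compacts (Fin n → ℂ)) [Nonempty X] :
    IsUniformAlgebra (polynomialAlgebra X) where
  nonempty := inferInstance
  closed := isClosed_polynomialAlgebra X
  separates x y hxy := by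
    obtain ⟨i, hi⟩ := Function.ne_iff.1 (Subtype.coe_ne_coe.2 hxy)
    refine ⟨_, (toPolynomialAlgebra X (MvPolynomial.X i)).2, ?_⟩
    simpa [toPolynomialAlgebra_apply] using hi

theorem isUnit_toPolynomialAlgebra (X : Compacts (Fin n → ℂ)) (p : MvPolynomial (Fin n) ℂ)
    {ρ : ℝ} (hρ : ρ < 1) (hρ0 : 0 ≤ ρ) (h : ∀ x ∈ X, ‖1 - MvPolynomial.eval x p‖ ≤ ρ) :
    IsUnit (toPolynomialAlgebra X p) := by
  have hn : ‖1 - toPolynomialAlgebra X p‖ ≤ ρ := by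
    refine (ContinuousMap.norm_le ((1 - toPolynomialAlgebra X p : polynomialAlgebra X) : C(X, ℂ))
      hρ0).2 ?_
    intro x
    have := h x x.2
    rw [← toPolynomialAlgebra_apply X p x] at this
    exact this
  simpa using isUnit_one_sub_of_norm_lt_one (hn.trans_lt hρ)

theorem hasDenseInvertibles_polynomialAlgebra (X : Compacts (Fin n → ℂ))
    (h : ∀ p : MvPolynomial (Fin n) ℂ, ∀ ε > 0, ∃ q, IsUnit (toPolynomialAlgebra X q) ∧
      ∀ x ∈ X, ‖MvPolynomial.eval x p - MvPolynomial.eval x q‖ ≤ ε) :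
    HasDenseInvertibles (polynomialAlgebra X) := by
  have : Set.range (toPolynomialAlgebra X) ⊆ closure {a | IsUnit a} := by
    rintro _ ⟨p, rfl⟩
    rw [Metric.mem_closure_iff]
    intro ε hε
    obtain ⟨q, hq, hpq⟩ := h p (ε / 2) (by positivity)
    refine ⟨_, hq, lt_of_le_of_lt ?_ (half_lt_self hε)⟩
    rw [dist_eq_norm]
    refine (ContinuousMap.norm_le ((toPolynomialAlgebra X p - toPolynomialAlgebra X q :
      polynomialAlgebra X) : C(X, ℂ)) (by positivity)).2 ?_
    intro x
    have := hpq x x.2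
    rw [← toPolynomialAlgebra_apply X p x, ← toPolynomialAlgebra_apply X q x] at this
    exact this
  exact dense_closure.1 ((denseRange_toPolynomialAlgebra X).mono this)

theorem mem_of_forall_norm_eval_le (K : Compacts (Fin n → ℂ)) {z : Fin n → ℂ}
    (hz : ∀ p : MvPolynomial (Fin n) ℂ, ‖MvPolynomial.eval z p‖ₑ ≤
      uniformNormOn (polynomialHull K : Set (Fin n → ℂ)) fun y => MvPolynomial.eval y p) :
    z ∈ polynomialHull K :=
  fun p => (hz p).trans (iSup₂_le fun _ hy => hy p)

/-- A character is determined by its values `z` on the coordinates, and since it is contractive, `z`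
lies in the hull of the hull, which is the hull. -/
theorem isNatural_polynomialAlgebra_polynomialHull (K : Compacts (Fin n → ℂ)) :
    IsNatural (polynomialAlgebra (polynomialHull K)) := by
  set X := polynomialHull K
  refine isHomeomorph_iff_continuous_bijective.2 ⟨?_, ?_, ?_⟩
  · refine Continuous.subtype_mk (WeakDual.continuous_of_continuous_eval fun f => ?_) _
    exact (f : C(X, ℂ)).continuous
  · intro x y hxy
    refine Subtype.ext (funext fun i => ?_)
    have h := DFunLike.congr_fun hxy (toPolynomialAlgebra X (MvPolynomial.X i))
    simpa [evalCharacter_apply, toPolynomialAlgebra_apply] using h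
  · intro φ
    let z : Fin n → ℂ := fun i => φ (toPolynomialAlgebra X (MvPolynomial.X i))
    have hφ : ∀ p, φ (toPolynomialAlgebra X p) = MvPolynomial.eval z p := fun p => by
      have : ((WeakDual.CharacterSpace.toAlgHom φ).comp (toPolynomialAlgebra X)) =
          MvPolynomial.aeval z := MvPolynomial.algHom_ext fun i => by simp [z]
      simpa [MvPolynomial.aeval_eq_eval] using DFunLike.congr_fun this p
    have hz : z ∈ X := mem_of_forall_norm_eval_le K fun p => by
      set N := uniformNormOn (X : Set (Fin n → ℂ)) fun y => MvPolynomial.eval y p with hN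
      have hNt : N ≠ ∞ := uniformNormOn_ne_top X.isCompact (MvPolynomial.continuous_eval p)
      have h1 : ‖(1 : polynomialAlgebra X)‖ ≤ 1 :=
        (ContinuousMap.norm_le ((1 : polynomialAlgebra X) : C(X, ℂ)) zero_le_one).2 (by simp)
      have h2 : ‖toPolynomialAlgebra X p‖ ≤ N.toReal := by
        refine (ContinuousMap.norm_le (toPolynomialAlgebra X p : C(X, ℂ))
          ENNReal.toReal_nonneg).2 fun x => ?_
        rw [toPolynomialAlgebra_apply, ← toReal_enorm]
        exact ENNReal.toReal_mono hNt
          (le_iSup₂ (f := fun y (_ : y ∈ (X : Set (Fin n → ℂ))) => ‖MvPolynomial.eval y p‖ₑ)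
            x.1 x.2)
      have h3 : ‖φ (toPolynomialAlgebra X p)‖ ≤ N.toReal :=
        calc ‖φ (toPolynomialAlgebra X p)‖
            ≤ ‖toPolynomialAlgebra X p‖ * ‖(1 : polynomialAlgebra X)‖ :=
              AlgHom.norm_apply_le_self_mul_norm_one (WeakDual.CharacterSpace.toAlgHom φ) _
          _ ≤ N.toReal * 1 := by gcongr
          _ = N.toReal := mul_one _
      rw [← hφ, ← ofReal_norm]
      exact ENNReal.ofReal_le_of_le_toReal h3
    refine ⟨⟨z, hz⟩, ?_⟩
    have heq : (fun f => evalCharacter (polynomialAlgebra X) ⟨z, hz⟩ f) = fun f => φ f := by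
      refine (denseRange_toPolynomialAlgebra X).equalizer (map_continuous _) (map_continuous _) ?_
      funext p
      simp [evalCharacter_apply, toPolynomialAlgebra_apply, hφ]
    exact DFunLike.ext _ _ fun f => congrFun heq f

end PolynomialAlgebra

/-! ### Construction of `Y` and proof of the theorem. -/

open Metric

theorem closedBidisk_eq_closedBall : closedBidisk = closedBall (0 : Fin 2 → ℂ) 1 := by
  ext z
  simp [closedBidisk, pi_norm_le_iff_of_nonneg]

theorem frontier_closedBidisk : frontier closedBidisk = sphere (0 : Fin 2 → ℂ) 1 := by
  rw [closedBidisk_eq_closedBall, frontier_closedBall _ one_ne_zero]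

theorem MvPolynomial.exists_forall_norm_eval_le {n : ℕ} (p : MvPolynomial (Fin n) ℂ)
    {K : Set (Fin n → ℂ)} (hK : IsCompact K) : ∃ B, 1 ≤ B ∧ ∀ x ∈ K, ‖eval x p‖ ≤ B := by
  obtain ⟨B, hB⟩ := hK.exists_bound_of_continuousOn (continuous_eval p).continuousOn
  exact ⟨max 1 B, le_max_left _ _, fun x hx => (hB x hx).trans (le_max_right _ _)⟩

/-- A countable set of polynomials which do not vanish at `a` is uniformly dense, on a given compact
set, in the polynomials. -/
theorem exists_dense_seq_eval_ne_zero {n : ℕ} (K : Compacts (Fin n → ℂ)) (a : Fin n → ℂ) :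
    ∃ g : ℕ → MvPolynomial (Fin n) ℂ, (∀ k, MvPolynomial.eval a (g k) ≠ 0) ∧
      ∀ p : MvPolynomial (Fin n) ℂ, ∀ ε > 0, ∃ k, ∀ x ∈ K,
        ‖MvPolynomial.eval x p - MvPolynomial.eval x (g k)‖ ≤ ε := by
  obtain ⟨c, hcS, hc, hSc⟩ := (TopologicalSpace.IsSeparable.of_separableSpace
    (restrictPolynomial K '' {p | MvPolynomial.eval a p ≠ 0})).exists_countable_dense_subset
  have hne : c.Nonempty := by
    rw [← closure_nonempty_iff]
    exact ⟨_, hSc ⟨1, by simp, rfl⟩⟩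
  obtain ⟨f, rfl⟩ := hc.exists_eq_range hne
  choose g hga hgf using fun k => hcS ⟨k, rfl⟩
  refine ⟨g, hga, fun p ε hε => ?_⟩
  -- At most one constant makes `p + δ` vanish at `a`, so one of `ε / 2`, `ε / 4` works.
  obtain ⟨δ, hδ, hδε, hpδ⟩ : ∃ δ : ℂ, δ ≠ 0 ∧ ‖δ‖ ≤ ε / 2 ∧ MvPolynomial.eval a p + δ ≠ 0 := by
    by_cases h : MvPolynomial.eval a p + (ε / 2 : ℝ) = 0
    · refine ⟨(ε / 4 : ℝ), by simpa using hε.ne', ?_, fun h' => ?_⟩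
      · rw [Complex.norm_real, Real.norm_of_nonneg (by positivity)]; linarith
      · have := Complex.ofReal_injective (add_left_cancel (h.trans h'.symm))
        linarith
    · exact ⟨(ε / 2 : ℝ), by simpa using hε.ne',
        by rw [Complex.norm_real, Real.norm_of_nonneg (by positivity)], h⟩
  obtain ⟨_, ⟨k, rfl⟩, hk⟩ := Metric.mem_closure_iff.1
    (hSc ⟨p + MvPolynomial.C δ, by simpa using hpδ, rfl⟩) (ε / 2) (by positivity)
  refine ⟨k, fun x hx => ?_⟩
  have h1 := (ContinuousMap.dist_apply_le_dist (⟨x, hx⟩ : K)).trans hk.le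
  rw [← hgf k, restrictPolynomial_apply, restrictPolynomial_apply, dist_eq_norm] at h1
  simp only [map_add, MvPolynomial.eval_C] at h1
  calc ‖MvPolynomial.eval x p - MvPolynomial.eval x (g k)‖
      = ‖(MvPolynomial.eval x p + δ - MvPolynomial.eval x (g k)) - δ‖ := by ring_nf
    _ ≤ ε / 2 + ε / 2 := (norm_sub_le _ _).trans (add_le_add h1 hδε)
    _ = ε := add_halves ε

/-- With `L = B²`, `|ζ + L|² ≤ |ζ|² + L + L² ≤ 2L + L² < (1 + L)²`: the half plane `Re ζ ≤ 1/2`, cut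
by a large disc, fits in a disc about `-L` that excludes 1. -/
theorem exists_norm_mul_pow_lt {B M : ℝ} (hM : 1 ≤ M) :
    ∃ (L : ℝ) (m : ℕ), 0 ≤ L ∧ ∀ ζ : ℂ, ‖ζ‖ ≤ B → ζ.re ≤ 1 / 2 →
      M * ‖(ζ + L) / (1 + L)‖ ^ m < 1 / 2 := by
  set L : ℝ := B ^ 2 with hL
  have hL0 : 0 ≤ L := sq_nonneg B
  set ρ : ℝ := Real.sqrt ((2 * L + L ^ 2) / (1 + L) ^ 2) with hρ
  have hρ1 : ρ < 1 := by
    rw [hρ, Real.sqrt_lt' one_pos, one_pow, div_lt_one (by positivity)]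
    linarith
  obtain ⟨m, hm⟩ := exists_pow_lt_of_lt_one (show (0 : ℝ) < 1 / (2 * M) by positivity) hρ1
  refine ⟨L, m, hL0, fun ζ hζ hre => ?_⟩
  have h1 : ‖(ζ + L) / (1 + L)‖ ≤ ρ := by
    refine Real.le_sqrt_of_sq_le ?_
    have : ‖(1 + L : ℂ)‖ = 1 + L := by
      rw [← Complex.ofReal_one, ← Complex.ofReal_add, Complex.norm_real,
        Real.norm_of_nonneg (by positivity)]
    rw [norm_div, this, div_pow]
    gcongr
    have h2 : ‖ζ‖ ^ 2 ≤ L := pow_le_pow_left₀ (norm_nonneg _) hζ 2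
    rw [Complex.sq_norm, Complex.normSq_apply] at h2 ⊢
    simp only [Complex.add_re, Complex.ofReal_re, Complex.add_im, Complex.ofReal_im, add_zero]
    nlinarith
  calc M * ‖(ζ + L) / (1 + L)‖ ^ m ≤ M * ρ ^ m := by gcongr
    _ < M * (1 / (2 * M)) := by gcongr
    _ = 1 / 2 := by field_simp

/-- Multiplying the normalised `g` by a high power of `(q + L) / (1 + L)` keeps the value 1 at 0,
and makes the product smaller than 1/2 in modulus wherever `Re q ≤ 1/2` on `K`. -/
theorem exists_dvd_re_eval_le {K : Set (Fin 2 → ℂ)} (hK : IsCompact K)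
    (g q : MvPolynomial (Fin 2) ℂ) (hg : MvPolynomial.eval 0 g ≠ 0)
    (hq : MvPolynomial.eval 0 q = 1) :
    ∃ q', MvPolynomial.eval 0 q' = 1 ∧ g ∣ q' ∧ ∀ x ∈ K,
      1 / 2 ≤ (MvPolynomial.eval x q').re → 1 / 2 ≤ (MvPolynomial.eval x q).re := by
  set c := (MvPolynomial.eval 0 g)⁻¹ with hc
  obtain ⟨M, hM, hgM⟩ := (MvPolynomial.C c * g).exists_forall_norm_eval_le hK
  obtain ⟨B, -, hqB⟩ := q.exists_forall_norm_eval_le hK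
  obtain ⟨L, m, hL, hLm⟩ := exists_norm_mul_pow_lt (B := B) hM
  have hL1 : (1 + L : ℂ) ≠ 0 := by
    rw [← Complex.ofReal_one, ← Complex.ofReal_add, Complex.ofReal_ne_zero]; positivity
  refine ⟨MvPolynomial.C c * g *
    (MvPolynomial.C (1 + L : ℂ)⁻¹ * (q + MvPolynomial.C (L : ℂ))) ^ m, ?_, ?_, fun x hx h => ?_⟩
  · simp only [map_mul, map_pow, map_add, MvPolynomial.eval_C, hq, hc]
    rw [inv_mul_cancel₀ hg, inv_mul_cancel₀ hL1, one_pow, one_mul]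
  · exact ((dvd_mul_left g _)).mul_right _
  · by_contra! hlt
    have h1 := hLm _ (hqB x hx) hlt.le
    have h2 := Complex.re_le_norm (MvPolynomial.eval x (MvPolynomial.C c * g *
      (MvPolynomial.C (1 + L : ℂ)⁻¹ * (q + MvPolynomial.C (L : ℂ))) ^ m))
    rw [map_mul, map_pow, map_mul _ (MvPolynomial.C _) (q + _), map_add, MvPolynomial.eval_C,
      MvPolynomial.eval_C, inv_mul_eq_div, norm_mul, norm_pow] at h2
    have h3 : ‖MvPolynomial.eval x (MvPolynomial.C c * g)‖ *
        ‖(MvPolynomial.eval x q + L) / (1 + L)‖ ^ m ≤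
        M * ‖(MvPolynomial.eval x q + L) / (1 + L)‖ ^ m := by
      gcongr
      exact hgM x hx
    rw [map_mul _ (MvPolynomial.C c * g), map_pow, map_mul _ (MvPolynomial.C _) (q + _), map_add,
      MvPolynomial.eval_C, MvPolynomial.eval_C, inv_mul_eq_div] at h
    linarith

theorem exists_seq_dvd_re_eval_le {K : Set (Fin 2 → ℂ)} (hK : IsCompact K)
    (g : ℕ → MvPolynomial (Fin 2) ℂ) (hg : ∀ k, MvPolynomial.eval 0 (g k) ≠ 0) :
    ∃ q : ℕ → MvPolynomial (Fin 2) ℂ, (∀ k, MvPolynomial.eval 0 (q k) = 1) ∧ (∀ k, g k ∣ q k) ∧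
      ∀ k, ∀ x ∈ K, 1 / 2 ≤ (MvPolynomial.eval x (q (k + 1))).re →
        1 / 2 ≤ (MvPolynomial.eval x (q k)).re := by
  choose F hF0 hFg hF using fun (k : ℕ)
    (q : {q : MvPolynomial (Fin 2) ℂ // MvPolynomial.eval 0 q = 1}) =>
      exists_dvd_re_eval_le hK (g k) q.1 (hg k) q.2
  let q : ℕ → {q : MvPolynomial (Fin 2) ℂ // MvPolynomial.eval 0 q = 1} := fun k =>
    -- The constant 1 is only the seed, so that `q 0` is already a multiple of `g 0`.
    Nat.rec ⟨F 0 ⟨1, by simp⟩, hF0 _ _⟩ (fun k p => ⟨F (k + 1) p, hF0 _ _⟩) k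
  refine ⟨fun k => (q k).1, fun k => (q k).2, fun k => ?_, fun k => hF (k + 1) (q k)⟩
  cases k with
  | zero => exact hFg _ _
  | succ k => exact hFg _ _

/-- The hull sees only bounds on moduli, so `Re q ≥ 1/2` is converted into one: for `t = 1 / (2B²)`,
`|1 - tq|² ≤ 1 - t + t²B² = 1 - t/2`. -/
theorem exists_norm_one_sub_le {K : Set (Fin 2 → ℂ)} (hK : IsCompact K)
    (q : MvPolynomial (Fin 2) ℂ) :
    ∃ (c : ℂ) (ρ : ℝ), 0 ≤ ρ ∧ ρ < 1 ∧ ∀ x ∈ K, 1 / 2 ≤ (MvPolynomial.eval x q).re →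
      ‖1 - MvPolynomial.eval x (MvPolynomial.C c * q)‖ ≤ ρ := by
  obtain ⟨B, hB, hqB⟩ := q.exists_forall_norm_eval_le hK
  have hB0 : 0 < B := by linarith
  set t : ℝ := 1 / (2 * B ^ 2) with ht
  have ht0 : 0 < t := by positivity
  have htB : t * B ^ 2 = 1 / 2 := by rw [ht]; field_simp
  refine ⟨(t : ℂ), Real.sqrt (1 - t / 2), Real.sqrt_nonneg _, ?_, fun x hx hre => ?_⟩
  · rw [Real.sqrt_lt' one_pos]; linarith
  · refine Real.le_sqrt_of_sq_le ?_
    have h2 : ‖MvPolynomial.eval x q‖ ^ 2 ≤ B ^ 2 := pow_le_pow_left₀ (norm_nonneg _) (hqB x hx) 2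
    rw [map_mul, MvPolynomial.eval_C]
    rw [Complex.sq_norm, Complex.normSq_apply] at h2 ⊢
    simp only [Complex.sub_re, Complex.one_re, Complex.re_ofReal_mul, Complex.sub_im,
      Complex.one_im, Complex.im_ofReal_mul]
    set u := (MvPolynomial.eval x q).re
    set v := (MvPolynomial.eval x q).im
    have h3 : t ^ 2 * (u * u + v * v) ≤ t * (1 / 2) := by
      calc t ^ 2 * (u * u + v * v) ≤ t ^ 2 * B ^ 2 := mul_le_mul_of_nonneg_left h2 (sq_nonneg t)
        _ = t * (t * B ^ 2) := by ring
        _ = t * (1 / 2) := by rw [htB]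
    nlinarith

theorem exists_compact_subset_sphere : ∃ Y : Compacts (Fin 2 → ℂ),
    (Y : Set (Fin 2 → ℂ)) ⊆ sphere 0 1 ∧ (0 : Fin 2 → ℂ) ∈ polynomialHull Y ∧
      HasDenseInvertibles (polynomialAlgebra Y) ∧
      HasDenseInvertibles (polynomialAlgebra (polynomialHull Y)) := by
  let K : Compacts (Fin 2 → ℂ) := ⟨closedBall 0 1, isCompact_closedBall 0 1⟩
  obtain ⟨g, hg0, hg⟩ := exists_dense_seq_eval_ne_zero K 0
  obtain ⟨q, hq0, hgq, hq⟩ := exists_seq_dvd_re_eval_le K.isCompact g hg0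
  have hcl : ∀ k, IsClosed {x | 1 / 2 ≤ (MvPolynomial.eval x (q k)).re} := fun k =>
    isClosed_le continuous_const (Complex.continuous_re.comp (MvPolynomial.continuous_eval _))
  let Y : Compacts (Fin 2 → ℂ) := ⟨sphere 0 1 ∩ ⋂ k, {x | 1 / 2 ≤ (MvPolynomial.eval x (q k)).re},
    (isCompact_sphere 0 1).inter_right (isClosed_iInter hcl)⟩
  have hYK : ∀ x ∈ Y, x ∈ K := fun x hx => sphere_subset_closedBall hx.1
  have hYq : ∀ x ∈ Y, ∀ k, 1 / 2 ≤ (MvPolynomial.eval x (q k)).re := fun x hx k =>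
    Set.mem_iInter.1 hx.2 k
  have hhull : ∀ (p : MvPolynomial (Fin 2) ℂ) (C : ℝ), 0 ≤ C →
      (∀ x ∈ Y, ‖MvPolynomial.eval x p‖ ≤ C) →
      ∀ x ∈ polynomialHull Y, ‖MvPolynomial.eval x p‖ ≤ C := by
    intro p C hC hp x hx
    have h1 : ‖MvPolynomial.eval x p‖ₑ ≤ ENNReal.ofReal C := (hx p).trans (iSup₂_le fun y hy => by
      rw [← ofReal_norm]; exact ENNReal.ofReal_le_ofReal (hp y hy))
    rwa [← ofReal_norm, ENNReal.ofReal_le_ofReal_iff hC] at h1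
  have hHK : ∀ x ∈ polynomialHull Y, x ∈ K := fun x hx => by
    refine mem_closedBall_zero_iff.2 ((pi_norm_le_iff_of_nonneg zero_le_one).2 fun i => ?_)
    have := hhull (MvPolynomial.X i) 1 zero_le_one (fun y hy => by
      rw [MvPolynomial.eval_X]
      exact (norm_le_pi_norm y i).trans (mem_closedBall_zero_iff.1 (hYK y hy))) x hx
    rwa [MvPolynomial.eval_X] at this
  -- Stated for any `X` that inherits modulus bounds from `Y`, so as to cover both `Y` and its hull.
  have hdense : ∀ X : Compacts (Fin 2 → ℂ), (∀ x ∈ X, x ∈ K) →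
      (∀ (p : MvPolynomial (Fin 2) ℂ) (C : ℝ), 0 ≤ C → (∀ x ∈ Y, ‖MvPolynomial.eval x p‖ ≤ C) →
        ∀ x ∈ X, ‖MvPolynomial.eval x p‖ ≤ C) →
      HasDenseInvertibles (polynomialAlgebra X) := by
    intro X hXK hX
    refine hasDenseInvertibles_polynomialAlgebra X fun p ε hε => ?_
    obtain ⟨k, hk⟩ := hg p ε hε
    refine ⟨g k, ?_, fun x hx => hk x (hXK x hx)⟩
    obtain ⟨c, ρ, hρ0, hρ1, hc⟩ := exists_norm_one_sub_le K.isCompact (q k)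
    refine isUnit_of_dvd_unit
      (map_dvd (toPolynomialAlgebra X) ((hgq k).mul_left (MvPolynomial.C c)))
      (isUnit_toPolynomialAlgebra X _ hρ1 hρ0 fun x hx => ?_)
    have := hX (1 - MvPolynomial.C c * q k) ρ hρ0 (fun y hy => by
      rw [map_sub, map_one]; exact hc y (hYK y hy) (hYq y hy k)) x hx
    rwa [map_sub, map_one] at this
  refine ⟨Y, Set.inter_subset_left, fun p => ?_, hdense Y hYK fun p C _ h => h,
    hdense _ hHK hhull⟩
  -- The `t k` are compact and decreasing, and nonempty by the maximum principle on `{q k = 1}`; a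
  -- common point lies in `Y` and dominates `|p 0|`.
  let t : ℕ → Set (Fin 2 → ℂ) := fun k =>
    sphere 0 1 ∩ ({x | 1 / 2 ≤ (MvPolynomial.eval x (q k)).re} ∩
      {x | ‖MvPolynomial.eval 0 p‖ ≤ ‖MvPolynomial.eval x p‖})
  have htcl : ∀ k, IsClosed ({x | 1 / 2 ≤ (MvPolynomial.eval x (q k)).re} ∩
      {x | ‖MvPolynomial.eval 0 p‖ ≤ ‖MvPolynomial.eval x p‖}) := fun k =>
    (hcl k).inter (isClosed_le continuous_const (MvPolynomial.continuous_eval p).norm)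
  have htc : ∀ k, IsCompact (t k) := fun k => (isCompact_sphere 0 1).inter_right (htcl k)
  obtain ⟨x, hx⟩ := IsCompact.nonempty_iInter_of_sequence_nonempty_isCompact_isClosed t
    (fun k x hx => ⟨hx.1, hq k x (sphere_subset_closedBall hx.1) hx.2.1, hx.2.2⟩)
    (fun k => by
      obtain ⟨x, hx, hxq, hxp⟩ := exists_mem_sphere_norm_eval_le (q k - 1) p
        (by rw [map_sub, map_one, hq0, sub_self])
      rw [map_sub, map_one, sub_eq_zero] at hxq
      refine ⟨x, hx, ?_, hxp⟩
      rw [Set.mem_ofPred_eq, hxq]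
      norm_num)
    (htc 0) fun k => (htc k).isClosed
  rw [Set.mem_iInter] at hx
  have hxY : x ∈ (Y : Set (Fin 2 → ℂ)) := ⟨(hx 0).1, Set.mem_iInter.2 fun k => (hx k).2.1⟩
  exact (enorm_le_iff_norm_le.2 (hx 0).2.2).trans
    (le_iSup₂ (f := fun y (_ : y ∈ (Y : Set (Fin 2 → ℂ))) => ‖MvPolynomial.eval y p‖ₑ) x hxY)

/-- The set `Y` is a boundary for `P(Ŷ)`. -/
theorem isClosedBoundary_polynomialHull {n : ℕ} (Y : Compacts (Fin n → ℂ))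
    (hY : (Y : Set (Fin n → ℂ)).Nonempty) :
    IsClosedBoundary (polynomialAlgebra (polynomialHull Y)) {x | (x : Fin n → ℂ) ∈ Y} := by
  set X := polynomialHull Y
  have hcl : IsClosed {x : X | (x : Fin n → ℂ) ∈ Y} :=
    Y.isCompact.isClosed.preimage continuous_subtype_val
  have hYX : ∀ y ∈ Y, y ∈ X := fun y hy p =>
    le_iSup₂ (f := fun y (_ : y ∈ (Y : Set (Fin n → ℂ))) => ‖MvPolynomial.eval y p‖ₑ) y hy
  have hne : {x : X | (x : Fin n → ℂ) ∈ Y}.Nonempty := ⟨⟨_, hYX _ hY.some_mem⟩, hY.some_mem⟩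
  refine ⟨hcl, fun f hf x => ?_⟩
  obtain ⟨y, hy, hmax⟩ := hcl.isCompact.exists_isMaxOn hne f.continuous.norm.continuousOn
  refine ⟨y, hy, le_of_forall_pos_le_add fun ε hε => ?_⟩
  obtain ⟨_, ⟨p, rfl⟩, hp⟩ := Metric.mem_closure_iff.1
    (show f ∈ closure ((restrictPolynomial X).range : Set C(X, ℂ)) from hf) (ε / 2) (by positivity)
  have happ : ∀ z : X, ‖f z - MvPolynomial.eval (z : Fin n → ℂ) p‖ ≤ ε / 2 := fun z => by
    have := (ContinuousMap.dist_apply_le_dist z).trans hp.le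
    rw [dist_eq_norm] at this
    rw [← restrictPolynomial_apply]
    exact this
  have hpY : ∀ z ∈ (Y : Set (Fin n → ℂ)), ‖MvPolynomial.eval z p‖ ≤ ‖f y‖ + ε / 2 := fun z hz => by
    have h1 := happ ⟨z, hYX z hz⟩
    have h2 : ‖f ⟨z, hYX z hz⟩‖ ≤ ‖f y‖ := hmax hz
    have h3 := norm_le_norm_add_norm_sub (f ⟨z, hYX z hz⟩) (MvPolynomial.eval z p)
    linarith
  -- Membership of `x` in the hull transfers the bound for `p` from `Y` to `x`.
  have hpx : ‖MvPolynomial.eval (x : Fin n → ℂ) p‖ ≤ ‖f y‖ + ε / 2 := by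
    have h1 : ‖MvPolynomial.eval (x : Fin n → ℂ) p‖ₑ ≤ ENNReal.ofReal (‖f y‖ + ε / 2) :=
      (x.2 p).trans (iSup₂_le fun z hz => by
        rw [← ofReal_norm]; exact ENNReal.ofReal_le_ofReal (hpY z hz))
    rwa [← ofReal_norm, ENNReal.ofReal_le_ofReal_iff (by positivity)] at h1
  have h3 := norm_le_norm_add_norm_sub' (f x) (MvPolynomial.eval (x : Fin n → ℂ) p)
  linarith [happ x]

theorem theorem1p1 :
    ∃ Y : Compacts (Fin 2 → ℂ), (Y : Set (Fin 2 → ℂ)) ⊆ frontier closedBidisk ∧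
      (0 : Fin 2 → ℂ) ∈ polynomialHull Y ∧
      HasDenseInvertibles (polynomialAlgebra Y) ∧
      IsUniformAlgebra (polynomialAlgebra (polynomialHull Y)) ∧
      IsNatural (polynomialAlgebra (polynomialHull Y)) ∧
      HasDenseInvertibles (polynomialAlgebra (polynomialHull Y)) ∧
      ∃ Γ : Set (polynomialHull Y),
        IsShilovBoundary (polynomialAlgebra (polynomialHull Y)) Γ ∧ Γ ⊂ Set.univ := by
  obtain ⟨Y, hYs, h0, hdY, hdX⟩ := exists_compact_subset_sphere
  have hne : (Y : Set (Fin 2 → ℂ)).Nonempty := by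
    by_contra h
    have := h0 1
    simp [uniformNormOn, Set.not_nonempty_iff_eq_empty.1 h] at this
  have : Nonempty (polynomialHull Y) := ⟨⟨0, h0⟩⟩
  have hU := isUniformAlgebra_polynomialAlgebra (polynomialHull Y)
  obtain ⟨Γ, hΓ⟩ := exists_isShilovBoundary hU
  refine ⟨Y, frontier_closedBidisk ▸ hYs, h0, hdY, hU,
    isNatural_polynomialAlgebra_polynomialHull Y, hdX, Γ, hΓ,
    Set.ssubset_univ_iff.2 fun h => ?_⟩
  have h0Γ : (⟨0, h0⟩ : polynomialHull Y) ∈ Γ := h ▸ Set.mem_univ _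
  have h0Y : (0 : Fin 2 → ℂ) ∈ Y :=
    hΓ.2 (isClosedBoundary_iff.1 (isClosedBoundary_polynomialHull Y hne)) h0Γ
  simpa using hYs h0Y
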